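/- All games are short partizan combinatorial games under misère play (a player who is to move and has no move wins). Write $G\ge H$ if for every short game $X$ the misère outcome of $G+X$ is at least that of $H+X$ (from Left's point of view), $G=H$ if $G\ge H$ and $H\ge G$, and $G>H$ if $G\ge H$ and $G\ne H$. A *Left dead end* is a game such that it and all of its subpositions have no Left option. Let $\mathcal L$ be the commutative monoid of Left dead ends, up to $=$, under disjunctive sum. An option $G'$ of a Left dead end $G$ (necessarily a Right option) is *good* if $G$ has no option $G''$ with $G'>G''$. In $\mathcal L$, an *atom* is a non-invertible element $a$ such that $a=b+c$ implies that $b$ or $c$ is invertible; $a\mid b$ means $a+c=b$ for some $c\in\mathcal L$; a *prime* is a non-invertible $p$ such that $p\mid a+b$ implies $p\mid a$ or $p\mid b$. A *factorisation* of an element is a finite (possibly empty) sum of atoms, up to order, equal to it. An element is *uniquely factorisable* if it has exactly one factorisation, and *prime-factorisable* if it has a factorisation into atoms all of which are prime. A *strong atom* is an atom $a$ such that, up to a unit, the only divisors of the elements $n\cdot a$ ($n\ge 0$) are multiples of $a$. **Theorem.** Let $G$ be a Left dead end that has a good option which is prime-factorisable. Then $n\cdot G$ is uniquely factorisable for every integer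 $n\ge 0$. In particular, if $G$ is moreover an atom, then $G$ is a strong atom. -/

import Mathlib

namespace AddFactor

variable {M : Type*} [AddCommMonoid M]

/-- Divisibility in an additively written commutative monoid. -/
def Divides (a b : M) : Prop := ∃ c, a + c = b

/-- A non-invertible element `p` is prime if `p ∣ a + b` implies `p ∣ a` or `p ∣ b`. -/
def IsPrime (p : M) : Prop :=
  ¬ IsAddUnit p ∧ ∀ a b : M, Divides p (a + b) → Divides p a ∨ Divides p b

/-- A factorisation of `m`: a finite multiset of atoms (`AddIrreducible`) with sum `m`. -/
def IsFactorisation (s : Multiset M) (m : M) : Prop :=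
  (∀ a ∈ s, AddIrreducible a) ∧ s.sum = m

/-- There is exactly one factorisation up to rearrangement. -/
def UniquelyFactorisable (m : M) : Prop := ∃! s : Multiset M, IsFactorisation s m

/-- There is a factorisation all of whose members are prime. -/
def PrimeFactorisable (m : M) : Prop :=
  ∃ s : Multiset M, IsFactorisation s m ∧ ∀ p ∈ s, IsPrime p

/-- A strong atom: an atom `a` such that, up to a unit, the only divisors of the multiples
`n • a` are multiples of `a`. -/
def IsStrongAtom (a : M) : Prop :=
  AddIrreducible a ∧
    ∀ (n : ℕ) (b : M), Divides b (n • a) → ∃ (k : ℕ) (u : M), IsAddUnit u ∧ b = k • a + u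

end AddFactor

namespace Misere

/-- Short partizan game forms: finitely many Left options `L i` and Right options `R j`. -/
inductive Form : Type
  | mk (m n : ℕ) (L : Fin m → Form) (R : Fin n → Form) : Form

inductive Player : Type
  | left
  | right

namespace Form

def IsLeftOption (X : Form) : Form → Prop
  | mk _ _ L _ => ∃ i, L i = X

def IsRightOption (X : Form) : Form → Prop
  | mk _ _ _ R => ∃ j, R j = X

def IsOption (X G : Form) : Prop := IsLeftOption X G ∨ IsRightOption X G

/-- `X` is reached from `G` by a (possibly empty) sequence of moves, not necessarily
alternating. -/
def IsSubposition (X G : Form) : Prop := Relation.ReflTransGen IsOption X G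

def IsLeftEnd (G : Form) : Prop := ∀ X, ¬ IsLeftOption X G

def IsLeftDeadEnd (G : Form) : Prop := ∀ X, IsSubposition X G → IsLeftEnd X

/-- The empty game. -/
instance : Zero Form := ⟨mk 0 0 Fin.elim0 Fin.elim0⟩

/-- Auxiliary to the disjunctive sum: `G + ·`, given the functions `GL i + ·` and `GR j + ·`. -/
def addAux {m n : ℕ} (fL : Fin m → Form → Form) (fR : Fin n → Form → Form) : Form → Form
  | mk m' n' L' R' =>
    mk (m + m') (n + n')
      (Fin.addCases (fun i => fL i (mk m' n' L' R')) (fun i => addAux fL fR (L' i)))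
      (Fin.addCases (fun j => fR j (mk m' n' L' R')) (fun j => addAux fL fR (R' j)))

/-- The disjunctive sum; see `isLeftOption_add` and `isRightOption_add`. -/
def add : Form → Form → Form
  | mk _ _ L R => addAux (fun i => add (L i)) (fun j => add (R j))

instance : Add Form := ⟨add⟩

theorem isLeftOption_add {X G H : Form} : IsLeftOption X (G + H) ↔
    (∃ G', IsLeftOption G' G ∧ X = G' + H) ∨ (∃ H', IsLeftOption H' H ∧ X = G + H') := by
  rcases G with ⟨m, n, L, R⟩
  rcases H with ⟨m', n', L', R'⟩
  constructor
  · rintro ⟨i, rfl⟩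
    refine Fin.addCases (fun i => ?_) (fun i => ?_) i
    · exact Or.inl ⟨L i, ⟨i, rfl⟩, by simp only [Fin.addCases_left]; rfl⟩
    · exact Or.inr ⟨L' i, ⟨i, rfl⟩, by simp only [Fin.addCases_right]; rfl⟩
  · rintro (⟨_, ⟨i, rfl⟩, rfl⟩ | ⟨_, ⟨i, rfl⟩, rfl⟩)
    · exact ⟨Fin.castAdd m' i, by simp only [Fin.addCases_left]; rfl⟩
    · exact ⟨Fin.natAdd m i, by simp only [Fin.addCases_right]; rfl⟩

theorem isRightOption_add {X G H : Form} : IsRightOption X (G + H) ↔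
    (∃ G', IsRightOption G' G ∧ X = G' + H) ∨ (∃ H', IsRightOption H' H ∧ X = G + H') := by
  rcases G with ⟨m, n, L, R⟩
  rcases H with ⟨m', n', L', R'⟩
  constructor
  · rintro ⟨i, rfl⟩
    refine Fin.addCases (fun i => ?_) (fun i => ?_) i
    · exact Or.inl ⟨R i, ⟨i, rfl⟩, by simp only [Fin.addCases_left]; rfl⟩
    · exact Or.inr ⟨R' i, ⟨i, rfl⟩, by simp only [Fin.addCases_right]; rfl⟩
  · rintro (⟨_, ⟨i, rfl⟩, rfl⟩ | ⟨_, ⟨i, rfl⟩, rfl⟩)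
    · exact ⟨Fin.castAdd n' i, by simp only [Fin.addCases_left]; rfl⟩
    · exact ⟨Fin.natAdd n i, by simp only [Fin.addCases_right]; rfl⟩

theorem not_isLeftOption_zero (X : Form) : ¬ IsLeftOption X 0 := fun ⟨i, _⟩ => i.elim0

theorem not_isRightOption_zero (X : Form) : ¬ IsRightOption X 0 := fun ⟨i, _⟩ => i.elim0

/-- `LeftWins p G`: under misère play (a player who is to move and has no move wins), Left has a
winning strategy on `G` when player `p` moves first. -/
def LeftWins : Player → Form → Prop
  | .left, mk m _ L _ => m = 0 ∨ ∃ i, LeftWins .right (L i)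
  | .right, mk _ n _ R => n ≠ 0 ∧ ∀ j, LeftWins .left (R j)

theorem leftWins_left {G : Form} : LeftWins .left G ↔
    (∀ X, ¬ IsLeftOption X G) ∨ ∃ X, IsLeftOption X G ∧ LeftWins .right X := by
  rcases G with ⟨m, n, L, R⟩
  rcases m.eq_zero_or_pos with rfl | hm
  · exact iff_of_true (by simp [LeftWins]) (Or.inl fun X ⟨i, _⟩ => i.elim0)
  · simp only [LeftWins, IsLeftOption, hm.ne', false_or, exists_exists_eq_and]
    exact ⟨Or.inr, fun h => h.resolve_left fun h => h _ ⟨⟨0, hm⟩, rfl⟩⟩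

theorem leftWins_right {G : Form} : LeftWins .right G ↔
    (∃ X, IsRightOption X G) ∧ ∀ X, IsRightOption X G → LeftWins .left X := by
  rcases G with ⟨m, n, L, R⟩
  rcases n.eq_zero_or_pos with rfl | hn
  · exact iff_of_false (by simp [LeftWins]) (fun ⟨⟨X, i, _⟩, _⟩ => i.elim0)
  · simp only [LeftWins, IsRightOption, forall_exists_index, forall_apply_eq_imp_iff]
    exact and_congr (iff_of_true hn.ne' ⟨_, ⟨0, hn⟩, rfl⟩) Iff.rfl

/-- A relation under which options of related forms can be matched up. -/
def Bisim (r : Form → Form → Prop) : Prop :=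
  ∀ G H, r G H →
    (∀ X, IsLeftOption X G → ∃ Y, IsLeftOption Y H ∧ r X Y) ∧
    (∀ Y, IsLeftOption Y H → ∃ X, IsLeftOption X G ∧ r X Y) ∧
    (∀ X, IsRightOption X G → ∃ Y, IsRightOption Y H ∧ r X Y) ∧
    (∀ Y, IsRightOption Y H → ∃ X, IsRightOption X G ∧ r X Y)

/-- Isomorphic forms: equal as hereditarily finite trees with unordered options. -/
def Iso (G H : Form) : Prop := ∃ r, Bisim r ∧ r G H

theorem leftWins_bisim {r : Form → Form → Prop} (hr : Bisim r) :
    ∀ (G H : Form), r G H → ∀ p, (LeftWins p G ↔ LeftWins p H) := by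
  intro G
  induction G with
  | mk m n L R ihL ihR =>
    intro H hGH p
    obtain ⟨h1, h2, h3, h4⟩ := hr _ _ hGH
    have eL : ∀ X, IsLeftOption X (mk m n L R) → ∀ Y, r X Y →
        ∀ p, (LeftWins p X ↔ LeftWins p Y) := by
      rintro _ ⟨i, rfl⟩ Y hY p
      exact ihL i Y hY p
    have eR : ∀ X, IsRightOption X (mk m n L R) → ∀ Y, r X Y →
        ∀ p, (LeftWins p X ↔ LeftWins p Y) := by
      rintro _ ⟨i, rfl⟩ Y hY p
      exact ihR i Y hY p
    cases p with
    | left =>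
      rw [leftWins_left, leftWins_left]
      refine or_congr ⟨fun h Y hY => ?_, fun h X hX => ?_⟩ ⟨?_, ?_⟩
      · obtain ⟨X, hX, _⟩ := h2 Y hY
        exact h X hX
      · obtain ⟨Y, hY, _⟩ := h1 X hX
        exact h Y hY
      · rintro ⟨X, hX, hw⟩
        obtain ⟨Y, hY, hXY⟩ := h1 X hX
        exact ⟨Y, hY, (eL X hX Y hXY _).1 hw⟩
      · rintro ⟨Y, hY, hw⟩
        obtain ⟨X, hX, hXY⟩ := h2 Y hY
        exact ⟨X, hX, (eL X hX Y hXY _).2 hw⟩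
    | right =>
      rw [leftWins_right, leftWins_right]
      refine and_congr ⟨?_, ?_⟩ ⟨fun h Y hY => ?_, fun h X hX => ?_⟩
      · rintro ⟨X, hX⟩
        obtain ⟨Y, hY, _⟩ := h3 X hX
        exact ⟨Y, hY⟩
      · rintro ⟨Y, hY⟩
        obtain ⟨X, hX, _⟩ := h4 Y hY
        exact ⟨X, hX⟩
      · obtain ⟨X, hX, hXY⟩ := h4 Y hY
        exact (eR X hX Y hXY _).1 (h X hX)
      · obtain ⟨Y, hY, hXY⟩ := h3 X hX
        exact (eR X hX Y hXY _).2 (h Y hY)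

theorem Iso.leftWins {G H : Form} (h : Iso G H) (p : Player) :
    LeftWins p G ↔ LeftWins p H := by
  obtain ⟨r, hr, hGH⟩ := h
  exact leftWins_bisim hr G H hGH p

theorem Iso.add_right {G H : Form} (h : Iso G H) (X : Form) : Iso (G + X) (H + X) := by
  obtain ⟨r, hr, hGH⟩ := h
  refine ⟨fun A B => ∃ a b X, r a b ∧ A = a + X ∧ B = b + X, ?_, G, H, X, hGH, rfl, rfl⟩
  rintro _ _ ⟨a, b, X, hab, rfl, rfl⟩
  obtain ⟨h1, h2, h3, h4⟩ := hr _ _ hab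
  simp only [isLeftOption_add, isRightOption_add]
  refine ⟨?_, ?_, ?_, ?_⟩
  · rintro _ (⟨a', ha, rfl⟩ | ⟨X', hX, rfl⟩)
    · obtain ⟨b', hb, hr'⟩ := h1 a' ha
      exact ⟨_, Or.inl ⟨b', hb, rfl⟩, a', b', X, hr', rfl, rfl⟩
    · exact ⟨_, Or.inr ⟨X', hX, rfl⟩, a, b, X', hab, rfl, rfl⟩
  · rintro _ (⟨b', hb, rfl⟩ | ⟨X', hX, rfl⟩)
    · obtain ⟨a', ha, hr'⟩ := h2 b' hb
      exact ⟨_, Or.inl ⟨a', ha, rfl⟩, a', b', X, hr', rfl, rfl⟩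
    · exact ⟨_, Or.inr ⟨X', hX, rfl⟩, a, b, X', hab, rfl, rfl⟩
  · rintro _ (⟨a', ha, rfl⟩ | ⟨X', hX, rfl⟩)
    · obtain ⟨b', hb, hr'⟩ := h3 a' ha
      exact ⟨_, Or.inl ⟨b', hb, rfl⟩, a', b', X, hr', rfl, rfl⟩
    · exact ⟨_, Or.inr ⟨X', hX, rfl⟩, a, b, X', hab, rfl, rfl⟩
  · rintro _ (⟨b', hb, rfl⟩ | ⟨X', hX, rfl⟩)
    · obtain ⟨a', ha, hr'⟩ := h4 b' hb
      exact ⟨_, Or.inl ⟨a', ha, rfl⟩, a', b', X, hr', rfl, rfl⟩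
    · exact ⟨_, Or.inr ⟨X', hX, rfl⟩, a, b, X', hab, rfl, rfl⟩

theorem iso_zero_add (G : Form) : Iso (0 + G) G := by
  refine ⟨fun A B => A = 0 + B, ?_, rfl⟩
  rintro _ B rfl
  simp only [isLeftOption_add, isRightOption_add, not_isLeftOption_zero, not_isRightOption_zero,
    false_and, exists_false, false_or]
  exact ⟨fun X ⟨Y, h, e⟩ => ⟨Y, h, e⟩, fun Y h => ⟨_, ⟨Y, h, rfl⟩, rfl⟩,
    fun X ⟨Y, h, e⟩ => ⟨Y, h, e⟩, fun Y h => ⟨_, ⟨Y, h, rfl⟩, rfl⟩⟩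

theorem iso_add_comm (G H : Form) : Iso (G + H) (H + G) := by
  refine ⟨fun A B => ∃ a b : Form, A = a + b ∧ B = b + a, ?_, G, H, rfl, rfl⟩
  rintro _ _ ⟨a, b, rfl, rfl⟩
  simp only [isLeftOption_add, isRightOption_add]
  refine ⟨?_, ?_, ?_, ?_⟩ <;> rintro _ (⟨a', h, rfl⟩ | ⟨a', h, rfl⟩)
  all_goals first
    | exact ⟨_, Or.inr ⟨a', h, rfl⟩, _, _, rfl, rfl⟩
    | exact ⟨_, Or.inl ⟨a', h, rfl⟩, _, _, rfl, rfl⟩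

theorem iso_add_assoc (G H K : Form) : Iso (G + H + K) (G + (H + K)) := by
  refine ⟨fun A B => ∃ a b c : Form, A = a + b + c ∧ B = a + (b + c), ?_, G, H, K, rfl, rfl⟩
  rintro _ _ ⟨a, b, c, rfl, rfl⟩
  simp only [isLeftOption_add, isRightOption_add]
  refine ⟨?_, ?_, ?_, ?_⟩
  · rintro _ (⟨_, ⟨a', h, rfl⟩ | ⟨a', h, rfl⟩, rfl⟩ | ⟨a', h, rfl⟩)
    · exact ⟨_, Or.inl ⟨a', h, rfl⟩, _, _, _, rfl, rfl⟩
    · exact ⟨_, Or.inr ⟨_, Or.inl ⟨a', h, rfl⟩, rfl⟩, _, _, _, rfl, rfl⟩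
    · exact ⟨_, Or.inr ⟨_, Or.inr ⟨a', h, rfl⟩, rfl⟩, _, _, _, rfl, rfl⟩
  · rintro _ (⟨a', h, rfl⟩ | ⟨_, ⟨a', h, rfl⟩ | ⟨a', h, rfl⟩, rfl⟩)
    · exact ⟨_, Or.inl ⟨_, Or.inl ⟨a', h, rfl⟩, rfl⟩, _, _, _, rfl, rfl⟩
    · exact ⟨_, Or.inl ⟨_, Or.inr ⟨a', h, rfl⟩, rfl⟩, _, _, _, rfl, rfl⟩
    · exact ⟨_, Or.inr ⟨a', h, rfl⟩, _, _, _, rfl, rfl⟩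
  · rintro _ (⟨_, ⟨a', h, rfl⟩ | ⟨a', h, rfl⟩, rfl⟩ | ⟨a', h, rfl⟩)
    · exact ⟨_, Or.inl ⟨a', h, rfl⟩, _, _, _, rfl, rfl⟩
    · exact ⟨_, Or.inr ⟨_, Or.inl ⟨a', h, rfl⟩, rfl⟩, _, _, _, rfl, rfl⟩
    · exact ⟨_, Or.inr ⟨_, Or.inr ⟨a', h, rfl⟩, rfl⟩, _, _, _, rfl, rfl⟩
  · rintro _ (⟨a', h, rfl⟩ | ⟨_, ⟨a', h, rfl⟩ | ⟨a', h, rfl⟩, rfl⟩)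
    · exact ⟨_, Or.inl ⟨_, Or.inl ⟨a', h, rfl⟩, rfl⟩, _, _, _, rfl, rfl⟩
    · exact ⟨_, Or.inl ⟨_, Or.inr ⟨a', h, rfl⟩, rfl⟩, _, _, _, rfl, rfl⟩
    · exact ⟨_, Or.inr ⟨a', h, rfl⟩, _, _, _, rfl, rfl⟩

/-- The misère outcome of `G` is at most that of `H`, for the usual order on outcomes in which
a Left win is greatest, a Right win is least, and next-player and previous-player wins are
incomparable: whoever starts, if Left wins `G` then Left wins `H`. -/
def OutcomeLE (G H : Form) : Prop := ∀ p : Player, LeftWins p G → LeftWins p H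

/-- Comparison modulo the full misère universe: `G ≤ H` if the outcome of `G + X` is at most that
of `H + X` for all short games `X`. -/
instance : Preorder Form where
  le G H := ∀ X : Form, OutcomeLE (G + X) (H + X)
  le_refl _ _ _ := id
  le_trans _ _ _ h h' X p := h' X p ∘ h X p

theorem Iso.antisymmRel {G H : Form} (h : Iso G H) : AntisymmRel (· ≤ ·) G H :=
  ⟨fun X p => ((h.add_right X).leftWins p).1, fun X p => ((h.add_right X).leftWins p).2⟩

theorem add_le_add_right' {G H : Form} (h : G ≤ H) (K : Form) : G + K ≤ H + K := fun X p hw =>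
  ((iso_add_assoc H K X).leftWins p).2 (h (K + X) p (((iso_add_assoc G K X).leftWins p).1 hw))

theorem add_le_add' {G H G' H' : Form} (h : G ≤ H) (h' : G' ≤ H') : G + G' ≤ H + H' :=
  (add_le_add_right' h G').trans <| (iso_add_comm H G').antisymmRel.1.trans <|
    (add_le_add_right' h' H).trans (iso_add_comm H' H).antisymmRel.1

/-- A good Right option: a Right option `X` of `G` that is not strictly dominated, that is, no
Right option `Y` of `G` satisfies `Y < X` (Right prefers smaller games). -/
def IsGoodRightOption (X G : Form) : Prop :=
  IsRightOption X G ∧ ∀ Y, IsRightOption Y G → ¬ Y < X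

theorem isLeftDeadEnd_zero : IsLeftDeadEnd 0 := by
  intro X hX
  rcases Relation.ReflTransGen.cases_tail hX with rfl | ⟨Y, _, h | h⟩
  · exact not_isLeftOption_zero
  · exact absurd h (not_isLeftOption_zero Y)
  · exact absurd h (not_isRightOption_zero Y)

theorem isLeftDeadEnd_add {G H : Form} (hG : IsLeftDeadEnd G) (hH : IsLeftDeadEnd H) :
    IsLeftDeadEnd (G + H) := by
  have key : ∀ X Y, IsSubposition X Y →
      (∃ A B, IsSubposition A G ∧ IsSubposition B H ∧ Y = A + B) →
      ∃ A B, IsSubposition A G ∧ IsSubposition B H ∧ X = A + B := by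
    intro X Y hXY
    induction hXY with
    | refl => exact id
    | tail _ hbc ih =>
      rintro ⟨A, B, hA, hB, rfl⟩
      apply ih
      rcases hbc with h | h
      · rcases isLeftOption_add.1 h with ⟨A', hA', rfl⟩ | ⟨B', hB', rfl⟩
        · exact ⟨A', B, .head (.inl hA') hA, hB, rfl⟩
        · exact ⟨A, B', hA, .head (.inl hB') hB, rfl⟩
      · rcases isRightOption_add.1 h with ⟨A', hA', rfl⟩ | ⟨B', hB', rfl⟩
        · exact ⟨A', B, .head (.inr hA') hA, hB, rfl⟩
        · exact ⟨A, B', hA, .head (.inr hB') hB, rfl⟩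
  intro X hX
  obtain ⟨A, B, hA, hB, rfl⟩ := key X _ hX ⟨G, H, .refl, .refl, rfl⟩
  intro Z hZ
  rcases isLeftOption_add.1 hZ with ⟨A', hA', _⟩ | ⟨B', hB', _⟩
  · exact hG A hA A' hA'
  · exact hH B hB B' hB'

end Form

/-- Left dead ends, as forms. -/
abbrev LeftDeadEnd : Type := {G : Form // G.IsLeftDeadEnd}

/-- The monoid of Left dead ends: Left dead ends modulo equality in the full misère universe,
`G = H` meaning `G ≤ H` and `H ≤ G`. -/
abbrev DeadEndMonoid : Type := Antisymmetrization LeftDeadEnd (· ≤ ·)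

/-- The class of a Left dead end in the monoid. -/
def LeftDeadEnd.value (G : LeftDeadEnd) : DeadEndMonoid := toAntisymmetrization (· ≤ ·) G

instance : Zero DeadEndMonoid := ⟨LeftDeadEnd.value ⟨0, Form.isLeftDeadEnd_zero⟩⟩

/-- The disjunctive sum on Left dead ends modulo equality. -/
instance : Add DeadEndMonoid where
  add := Quotient.map₂ (fun G H => ⟨G.1 + H.1, Form.isLeftDeadEnd_add G.2 H.2⟩)
    (fun _ _ h _ _ h' => ⟨Form.add_le_add' h.1 h'.1, Form.add_le_add' h.2 h'.2⟩)

instance : AddCommMonoid DeadEndMonoid where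
  add_assoc := by
    rintro ⟨a⟩ ⟨b⟩ ⟨c⟩
    exact Quotient.sound (Form.iso_add_assoc a.1 b.1 c.1).antisymmRel
  zero_add := by
    rintro ⟨a⟩
    exact Quotient.sound (Form.iso_zero_add a.1).antisymmRel
  add_zero := by
    rintro ⟨a⟩
    exact Quotient.sound
      ((Form.iso_add_comm a.1 0).antisymmRel.trans (Form.iso_zero_add a.1).antisymmRel)
  add_comm := by
    rintro ⟨a⟩ ⟨b⟩
    exact Quotient.sound (Form.iso_add_comm a.1 b.1).antisymmRel
  nsmul := nsmulRec

end Misere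

/-! ### Factorisation in commutative monoids. -/

namespace AddFactor

variable {M : Type*} [AddCommMonoid M]

/-! Left dead ends are compared recursively through their Right options (`IsLeftDeadEnd.le_iff`).
This makes their monoid cancellative (`le_of_add_le_add`), and the additive norm `minLength` makes
it reduced and atomic. By cancellation, a good option of a sum is a good option of one summand plus
the rest (`IsGoodOption.of_sum`), and `a' + n • a` is a good option of `(n + 1) • a` whenever `a'`
is one of `a` (`IsGoodOption.add_nsmul`).

Let `a` be an atom with a prime-factorisable good option `a'`, and suppose `n • a` factors uniquely;
then so does `a' + n • a`. Given a factorisation of `(n + 1) • a`, this good option arises by moving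
in one of its atoms, so every other atom occurs in the unique factorisation of `a' + n • a`: it is
`a`, or a prime dividing `(n + 1) • a`, hence again `a`. Cancelling one `a` completes the induction
(`uniquelyFactorisable_nsmul_of_atom`). In general `G` is a prime-factorisable element plus such an
atom (`exists_eq_add_atom`), and adding primes preserves unique factorisation. -/

theorem IsFactorisation.cons {a m : M} {s : Multiset M} (ha : AddIrreducible a)
    (hs : IsFactorisation s m) : IsFactorisation (a ::ₘ s) (a + m) :=
  ⟨by simpa [ha] using hs.1, by simp [hs.2]⟩

theorem IsFactorisation.add {a b : M} {s t : Multiset M} (hs : IsFactorisation s a)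
    (ht : IsFactorisation t b) : IsFactorisation (s + t) (a + b) := by
  refine ⟨fun x hx => ?_, by simp [hs.2, ht.2]⟩
  rcases Multiset.mem_add.1 hx with h | h
  exacts [hs.1 x h, ht.1 x h]

theorem isFactorisation_replicate {a : M} (ha : AddIrreducible a) (n : ℕ) :
    IsFactorisation (Multiset.replicate n a) (n • a) :=
  ⟨fun _ hx => Multiset.eq_of_mem_replicate hx ▸ ha, by simp⟩

theorem UniquelyFactorisable.eq {m : M} {s t : Multiset M} (hm : UniquelyFactorisable m)
    (hs : IsFactorisation s m) (ht : IsFactorisation t m) : s = t :=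
  ExistsUnique.unique hm hs ht

theorem PrimeFactorisable.nsmul {m : M} (hm : PrimeFactorisable m) (n : ℕ) :
    PrimeFactorisable (n • m) := by
  obtain ⟨s, hs, hp⟩ := hm
  exact ⟨n • s, ⟨fun a ha => hs.1 a (Multiset.mem_of_mem_nsmul ha), by
    rw [Multiset.sum_nsmul, hs.2]⟩, fun a ha => hp a (Multiset.mem_of_mem_nsmul ha)⟩

/-- Factorisations of `b` and of its complement together form the only factorisation of `n • a`,
which consists of copies of `a`. -/
theorem UniquelyFactorisable.exists_eq_nsmul {a b : M} {n : ℕ} (ha : AddIrreducible a)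
    (hu : UniquelyFactorisable (n • a)) (hex : ∀ m : M, ∃ s, IsFactorisation s m)
    (hb : Divides b (n • a)) : ∃ k : ℕ, b = k • a := by
  obtain ⟨c, hc⟩ := hb
  obtain ⟨s, hs⟩ := hex b
  obtain ⟨t, ht⟩ := hex c
  have h := hu.eq (hc ▸ hs.add ht) (isFactorisation_replicate ha n)
  have h' : s = Multiset.replicate s.card a := Multiset.eq_replicate_card.2 fun x hx =>
    Multiset.eq_of_mem_replicate (h ▸ Multiset.mem_add.2 (.inl hx))
  exact ⟨s.card, by rw [← hs.2]; nth_rw 1 [h']; simp⟩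

variable [Subsingleton (AddUnits M)]

theorem IsFactorisation.eq_zero {s : Multiset M} (hs : IsFactorisation s 0) : s = 0 := by
  refine Multiset.eq_zero_of_forall_notMem fun a ha => ?_
  obtain ⟨t, rfl⟩ := Multiset.exists_cons_of_mem ha
  refine (hs.1 a ha).not_isAddUnit (IsAddUnit.of_add_eq_zero t.sum ?_)
  simpa using hs.2

theorem uniquelyFactorisable_zero : UniquelyFactorisable (0 : M) :=
  ⟨0, ⟨by simp, by simp⟩, fun _ ht => ht.eq_zero⟩

/-- A prime dividing the sum divides one of the atoms, and with no nonzero units it must equal that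
atom. -/
theorem IsPrime.mem_of_divides_sum {p : M} (hp : IsPrime p) {s : Multiset M}
    (hs : ∀ a ∈ s, AddIrreducible a) (h : Divides p s.sum) : p ∈ s := by
  induction s using Multiset.induction with
  | empty =>
    obtain ⟨c, hc⟩ := h
    exact absurd (IsAddUnit.of_add_eq_zero c (by simpa using hc)) hp.1
  | cons a s ih =>
    rw [Multiset.sum_cons] at h
    rcases hp.2 _ _ h with ⟨c, hc⟩ | h
    · rcases (hs a (by simp)).isAddUnit_or_isAddUnit hc.symm with h | h
      · exact absurd h hp.1
      · rw [isAddUnit_iff_eq_zero] at h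
        simp [← hc, h]
    · exact Multiset.mem_cons_of_mem (ih (fun b hb => hs b (Multiset.mem_cons_of_mem hb)) h)

/-- A norm vanishing only at zero makes the monoid atomic. -/
theorem exists_isFactorisation (f : M →+ ℕ) (hf : ∀ a, f a = 0 → a = 0) (m : M) :
    ∃ s, IsFactorisation s m := by
  induction h : f m using Nat.strong_induction_on generalizing m with
  | _ k ih =>
    by_cases h0 : m = 0
    · exact ⟨0, by simp, by simp [h0]⟩
    by_cases hm : AddIrreducible m
    · exact ⟨{m}, by simpa using hm, by simp⟩
    rw [addIrreducible_iff] at hm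
    push Not at hm
    obtain ⟨a, b, rfl, ha, hb⟩ := hm (by rwa [isAddUnit_iff_eq_zero])
    rw [isAddUnit_iff_eq_zero] at ha hb
    have h1 := mt (hf a) ha
    have h2 := mt (hf b) hb
    rw [map_add] at h
    obtain ⟨s, hs⟩ := ih (f a) (by omega) a rfl
    obtain ⟨t, ht⟩ := ih (f b) (by omega) b rfl
    exact ⟨s + t, hs.add ht⟩

variable [IsCancelAdd M]

/-- The prime `p` occurs in every factorisation of `p + u`, so it can be cancelled. -/
theorem UniquelyFactorisable.prime_add {p u : M} (hp : IsPrime p) (hpa : AddIrreducible p)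
    (hu : UniquelyFactorisable u) : UniquelyFactorisable (p + u) := by
  obtain ⟨s, hs, hs'⟩ := hu
  refine ⟨p ::ₘ s, hs.cons hpa, fun t ht => ?_⟩
  obtain ⟨t, rfl⟩ := Multiset.exists_cons_of_mem
    (hp.mem_of_divides_sum ht.1 ⟨u, ht.2.symm⟩)
  rw [hs' t ⟨fun a ha => ht.1 a (Multiset.mem_cons_of_mem ha), ?_⟩]
  have := ht.2
  rw [Multiset.sum_cons] at this
  exact add_left_cancel this

theorem PrimeFactorisable.add_uniquelyFactorisable {m u : M} (hm : PrimeFactorisable m)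
    (hu : UniquelyFactorisable u) : UniquelyFactorisable (m + u) := by
  obtain ⟨s, ⟨hs, rfl⟩, hp⟩ := hm
  induction s using Multiset.induction with
  | empty => simpa using hu
  | cons a s ih =>
    rw [Multiset.sum_cons, add_assoc]
    simp only [Multiset.mem_cons, forall_eq_or_imp] at hs hp
    exact (ih hp.2 hs.2).prime_add hp.1 hs.1

theorem PrimeFactorisable.isPrime_of_mem {m : M} (hm : PrimeFactorisable m) {s : Multiset M}
    (hs : IsFactorisation s m) : ∀ p ∈ s, IsPrime p := by
  have hu := hm.add_uniquelyFactorisable uniquelyFactorisable_zero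
  rw [add_zero] at hu
  obtain ⟨t, ht, hp⟩ := hm
  rwa [hu.eq hs ht]

end AddFactor

/-! ### The order on Left dead ends. -/

namespace Misere

namespace Form

def IsRightEnd (G : Form) : Prop := ∀ X, ¬ IsRightOption X G

theorem IsLeftDeadEnd.isLeftEnd {G : Form} (hG : IsLeftDeadEnd G) : IsLeftEnd G := hG G .refl

theorem IsLeftDeadEnd.rightOption {G X : Form} (hG : IsLeftDeadEnd G) (h : IsRightOption X G) :
    IsLeftDeadEnd X := fun Y hY => hG Y (hY.tail (.inr h))

theorem rightOption_induction {P : Form → Prop}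
    (h : ∀ G, (∀ X, IsRightOption X G → P X) → P G) (G : Form) : P G := by
  induction G with
  | mk m n L R _ ihR => exact h _ (by rintro _ ⟨j, rfl⟩; exact ihR j)

/-- One direction of the comparison of Left dead ends: Right can mirror his moves. -/
theorem le_of_rightOption {G H : Form} (hG : IsLeftEnd G) (hH : IsLeftEnd H)
    (h : ∀ X, IsRightOption X G → ∃ Y, IsRightOption Y H ∧ Y ≤ X)
    (h0 : IsRightEnd G → IsRightEnd H) : H ≤ G := by
  intro X
  induction X with
  | mk m n L R ihL ihR =>
    intro p hw
    cases p with
    | left =>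
      rw [leftWins_left] at hw ⊢
      simp only [isLeftOption_add] at hw ⊢
      rcases hw with hw | ⟨_, ⟨Y, hY, _⟩ | ⟨Y, ⟨i, rfl⟩, rfl⟩, hw⟩
      · refine .inl ?_
        rintro _ (⟨Y, hY, _⟩ | ⟨Y, hY, rfl⟩)
        · exact hG Y hY
        · exact hw _ (.inr ⟨Y, hY, rfl⟩)
      · exact absurd hY (hH Y)
      · exact .inr ⟨_, .inr ⟨_, ⟨i, rfl⟩, rfl⟩, ihL i _ hw⟩
    | right =>
      rw [leftWins_right] at hw ⊢
      simp only [isRightOption_add] at hw ⊢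
      obtain ⟨⟨Z, hZ⟩, hw⟩ := hw
      constructor
      · rcases hZ with ⟨Y, hY, _⟩ | ⟨Y, hY, _⟩
        · have : ¬ IsRightEnd G := fun hg => h0 hg Y hY
          simp only [IsRightEnd, not_forall, not_not] at this
          obtain ⟨W, hW⟩ := this
          exact ⟨_, .inl ⟨W, hW, rfl⟩⟩
        · exact ⟨_, .inr ⟨Y, hY, rfl⟩⟩
      · rintro _ (⟨Y, hY, rfl⟩ | ⟨Y, ⟨j, rfl⟩, rfl⟩)
        · obtain ⟨W, hW, hle⟩ := h Y hY
          exact hle _ _ (hw _ (.inl ⟨W, hW, rfl⟩))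
        · exact ihR j _ (hw _ (.inr ⟨_, ⟨j, rfl⟩, rfl⟩))

/-- Left can make `n` moves, Right none. -/
def leftMoves : ℕ → Form
  | 0 => 0
  | n + 1 => mk 1 0 (fun _ => leftMoves n) Fin.elim0

/-- Too many spare moves for Left let Right run out of moves first. -/
theorem exists_leftMoves (G : Form) (hG : IsLeftDeadEnd G) :
    ∃ N, ∀ n, N ≤ n → ¬ LeftWins .right (G + leftMoves n) := by
  induction G with
  | mk m n L R _ ihR =>
    have ih : ∀ j, ∃ N, ∀ n, N ≤ n → ¬ LeftWins .right (R j + leftMoves n) :=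
      fun j => ihR j (hG.rightOption ⟨j, rfl⟩)
    choose N hN using ih
    -- The extra move is Left's reply to Right's first move.
    refine ⟨Finset.univ.sup N + 1, fun k hk hw => ?_⟩
    obtain ⟨k, rfl⟩ : ∃ l, k = l + 1 := ⟨k - 1, by omega⟩
    rw [leftWins_right] at hw
    simp only [isRightOption_add] at hw
    obtain ⟨⟨_, ⟨_, ⟨j, rfl⟩, rfl⟩ | ⟨_, ⟨i, _⟩, _⟩⟩, hw⟩ := hw
    · have h1 := hw _ (.inl ⟨_, ⟨j, rfl⟩, rfl⟩)
      rw [leftWins_left] at h1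
      simp only [isLeftOption_add] at h1
      rcases h1 with h1 | ⟨_, ⟨Y, hY, _⟩ | ⟨_, ⟨i, rfl⟩, rfl⟩, h1⟩
      · exact h1 _ (.inr ⟨_, ⟨0, rfl⟩, rfl⟩)
      · exact (hG.rightOption ⟨j, rfl⟩).isLeftEnd Y hY
      · exact hN j k (by
          have := Finset.le_sup (f := N) (Finset.mem_univ j)
          omega) h1
    · exact i.elim0

/-- Comparison of outcomes with Right moving first. -/
def RightFirstLE (H G : Form) : Prop := ∀ X, LeftWins .right (H + X) → LeftWins .right (G + X)

/-- The test game is `0`: if Right could move in `H`, Left would then be unable to move and win,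
whereas in `G` Right wins at once. -/
theorem RightFirstLE.isRightEnd {G H : Form} (hH : IsLeftDeadEnd H) (h : RightFirstLE H G)
    (hG : IsRightEnd G) : IsRightEnd H := by
  intro Y hY
  have h1 : LeftWins .right (H + 0) := by
    rw [leftWins_right]
    simp only [isRightOption_add]
    refine ⟨⟨_, .inl ⟨Y, hY, rfl⟩⟩, ?_⟩
    rintro _ (⟨Z, hZ, rfl⟩ | ⟨Z, hZ, _⟩)
    · rw [leftWins_left]
      simp only [isLeftOption_add]
      refine .inl ?_
      rintro _ (⟨W, hW, _⟩ | ⟨W, hW, _⟩)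
      · exact (hH.rightOption hZ).isLeftEnd W hW
      · exact not_isLeftOption_zero W hW
    · exact absurd hZ (not_isRightOption_zero Z)
  have h2 := h 0 h1
  rw [leftWins_right] at h2
  simp only [isRightOption_add] at h2
  obtain ⟨⟨_, ⟨Z, hZ, _⟩ | ⟨Z, hZ, _⟩⟩, _⟩ := h2
  · exact hG Z hZ
  · exact not_isRightOption_zero Z hZ

/-- If every option of `H` failed, each would have a witness `Z j`, and a test game offering Left
exactly these replies would separate `H` from `G`. -/
theorem RightFirstLE.rightOption {G H X : Form} (hG : IsLeftDeadEnd G) (hH : IsLeftDeadEnd H)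
    (h : RightFirstLE H G) (hX : IsRightOption X G) :
    ∃ Y, IsRightOption Y H ∧ RightFirstLE Y X := by
  have hXd := hG.rightOption hX
  by_contra! hc
  rcases H with ⟨m, n, L, R⟩
  rcases n.eq_zero_or_pos with rfl | hn
  · obtain ⟨N, hN⟩ := exists_leftMoves X hXd
    -- With no options in `H`, the test game needs a Right move to `0`, lest Right win on `H` by
    -- having no move. Left's option `leftMoves N` makes her lose after Right moves to `X`.
    have h1 : LeftWins .right (mk m 0 L R + mk 1 1 (fun _ => leftMoves N) (fun _ => 0)) := by
      rw [leftWins_right]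
      simp only [isRightOption_add]
      refine ⟨⟨_, .inr ⟨_, ⟨0, rfl⟩, rfl⟩⟩, ?_⟩
      rintro _ (⟨_, ⟨j, _⟩, _⟩ | ⟨_, ⟨j, rfl⟩, rfl⟩)
      · exact j.elim0
      · rw [leftWins_left]
        simp only [isLeftOption_add]
        refine .inl ?_
        rintro _ (⟨W, hW, _⟩ | ⟨W, hW, _⟩)
        · exact hH.isLeftEnd W hW
        · exact not_isLeftOption_zero W hW
    have h2 := (leftWins_right.1 (h _ h1)).2 _ (isRightOption_add.2 (.inl ⟨X, hX, rfl⟩))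
    rw [leftWins_left] at h2
    simp only [isLeftOption_add] at h2
    rcases h2 with h2 | ⟨_, ⟨W, hW, _⟩ | ⟨_, ⟨i, rfl⟩, rfl⟩, h2⟩
    · exact h2 _ (.inr ⟨_, ⟨0, rfl⟩, rfl⟩)
    · exact hXd.isLeftEnd W hW
    · exact hN N le_rfl h2
  · have hc' : ∀ j, ∃ Z, LeftWins .right (R j + Z) ∧ ¬ LeftWins .right (X + Z) := by
      intro j
      simpa [RightFirstLE] using hc (R j) ⟨j, rfl⟩
    choose Z hZ hZ' using hc'
    have h1 : LeftWins .right (mk m n L R + mk n 0 Z Fin.elim0) := by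
      rw [leftWins_right]
      simp only [isRightOption_add]
      refine ⟨⟨_, .inl ⟨_, ⟨⟨0, hn⟩, rfl⟩, rfl⟩⟩, ?_⟩
      rintro _ (⟨_, ⟨j, rfl⟩, rfl⟩ | ⟨_, ⟨j, _⟩, _⟩)
      · rw [leftWins_left]
        exact .inr ⟨_, isLeftOption_add.2 (.inr ⟨_, ⟨j, rfl⟩, rfl⟩), hZ j⟩
      · exact j.elim0
    have h2 := (leftWins_right.1 (h _ h1)).2 _ (isRightOption_add.2 (.inl ⟨X, hX, rfl⟩))
    rw [leftWins_left] at h2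
    simp only [isLeftOption_add] at h2
    rcases h2 with h2 | ⟨_, ⟨W, hW, _⟩ | ⟨_, ⟨i, rfl⟩, rfl⟩, h2⟩
    · exact h2 _ (.inr ⟨_, ⟨⟨0, hn⟩, rfl⟩, rfl⟩)
    · exact hXd.isLeftEnd W hW
    · exact hZ' i h2

/-- Since `RightFirstLE` passes to Right options, Right can mirror at every stage. -/
theorem RightFirstLE.le {G H : Form} (hG : IsLeftDeadEnd G) (hH : IsLeftDeadEnd H)
    (h : RightFirstLE H G) : H ≤ G := by
  induction G using rightOption_induction generalizing H with
  | h G ih =>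
    refine le_of_rightOption hG.isLeftEnd hH.isLeftEnd (fun X hX => ?_) (h.isRightEnd hH)
    obtain ⟨Y, hY, hYX⟩ := h.rightOption hG hH hX
    exact ⟨Y, hY, ih X hX (hG.rightOption hX) (hH.rightOption hY) hYX⟩

/-- Comparison of Left dead ends in terms of their Right options. -/
theorem IsLeftDeadEnd.le_iff {G H : Form} (hG : IsLeftDeadEnd G) (hH : IsLeftDeadEnd H) :
    H ≤ G ↔ (∀ X, IsRightOption X G → ∃ Y, IsRightOption Y H ∧ Y ≤ X) ∧
      (IsRightEnd G → IsRightEnd H) := by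
  refine ⟨fun h => ?_, fun h => le_of_rightOption hG.isLeftEnd hH.isLeftEnd h.1 h.2⟩
  have h' : RightFirstLE H G := fun X => h X .right
  refine ⟨fun X hX => ?_, h'.isRightEnd hH⟩
  obtain ⟨Y, hY, hYX⟩ := h'.rightOption hG hH hX
  exact ⟨Y, hY, hYX.le (hG.rightOption hX) (hH.rightOption hY)⟩

/-! ### The norm and cancellation. -/

/-- The least length of a sequence of Right moves that exhausts his moves. -/
noncomputable def minLength : Form → ℕ
  | mk _ _ _ R => ⨅ j, (minLength (R j) + 1)

theorem IsRightEnd.minLength {G : Form} (hG : IsRightEnd G) : G.minLength = 0 := by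
  rcases G with ⟨m, n, L, R⟩
  rcases n.eq_zero_or_pos with rfl | hn
  -- The empty infimum in `ℕ` is `0`.
  · simp [Form.minLength]
  · exact absurd ⟨⟨0, hn⟩, rfl⟩ (hG _)

theorem IsRightOption.minLength_le {X G : Form} (h : IsRightOption X G) :
    G.minLength ≤ X.minLength + 1 := by
  rcases G with ⟨m, n, L, R⟩
  obtain ⟨j, rfl⟩ := h
  exact ciInf_le (OrderBot.bddBelow _) j

theorem exists_minLength_eq {G : Form} (hG : ¬ IsRightEnd G) :
    ∃ X, IsRightOption X G ∧ G.minLength = X.minLength + 1 := by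
  rcases G with ⟨m, n, L, R⟩
  simp only [IsRightEnd, not_forall, not_not] at hG
  obtain ⟨_, j, rfl⟩ := hG
  have : Nonempty (Fin n) := ⟨j⟩
  obtain ⟨i, hi⟩ := Nat.sInf_mem (Set.range_nonempty fun j => (R j).minLength + 1)
  exact ⟨R i, ⟨i, rfl⟩, hi.symm⟩

theorem minLength_eq_zero {G : Form} : G.minLength = 0 ↔ IsRightEnd G := by
  refine ⟨fun h => ?_, IsRightEnd.minLength⟩
  by_contra hG
  obtain ⟨X, -, h'⟩ := exists_minLength_eq hG
  omega

theorem isRightEnd_add {G H : Form} : IsRightEnd (G + H) ↔ IsRightEnd G ∧ IsRightEnd H := by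
  simp only [IsRightEnd, isRightOption_add]
  refine ⟨fun h => ⟨fun X hX => h _ (.inl ⟨X, hX, rfl⟩), fun X hX => h _ (.inr ⟨X, hX, rfl⟩)⟩, ?_⟩
  rintro ⟨h, h'⟩ _ (⟨X, hX, _⟩ | ⟨X, hX, _⟩)
  exacts [h X hX, h' X hX]

theorem minLength_add (G H : Form) : (G + H).minLength = G.minLength + H.minLength := by
  induction G using rightOption_induction generalizing H with
  | h G ihG =>
    induction H using rightOption_induction with
    | h H ihH =>
      apply le_antisymm
      · by_cases hG : IsRightEnd G
        · by_cases hH : IsRightEnd H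
          · rw [(isRightEnd_add.2 ⟨hG, hH⟩).minLength]
            exact Nat.zero_le _
          · obtain ⟨X, hX, e⟩ := exists_minLength_eq hH
            have := (isRightOption_add.2 (.inr ⟨X, hX, rfl⟩) :
              IsRightOption (G + X) (G + H)).minLength_le
            rw [ihH X hX] at this
            omega
        · obtain ⟨X, hX, e⟩ := exists_minLength_eq hG
          have := (isRightOption_add.2 (.inl ⟨X, hX, rfl⟩) :
            IsRightOption (X + H) (G + H)).minLength_le
          rw [ihG X hX] at this
          omega
      · by_cases h : IsRightEnd (G + H)
        · obtain ⟨h1, h2⟩ := isRightEnd_add.1 h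
          simp [h1.minLength, h2.minLength]
        · obtain ⟨_, hXG, e⟩ := exists_minLength_eq h
          rcases isRightOption_add.1 hXG with ⟨X, hX, rfl⟩ | ⟨X, hX, rfl⟩
          · have := hX.minLength_le
            rw [ihG X hX] at e
            omega
          · have := hX.minLength_le
            rw [ihH X hX] at e
            omega

/-- A shortest exhausting sequence in `G` is shadowed in `H` through smaller options. -/
theorem minLength_mono {G H : Form} (hG : IsLeftDeadEnd G) (hH : IsLeftDeadEnd H)
    (h : H ≤ G) : H.minLength ≤ G.minLength := by
  induction G using rightOption_induction generalizing H with
  | h G ih =>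
    obtain ⟨h1, h2⟩ := (hG.le_iff hH).1 h
    by_cases hr : IsRightEnd G
    · simp [(h2 hr).minLength]
    · obtain ⟨X, hX, e⟩ := exists_minLength_eq hr
      obtain ⟨Y, hY, hYX⟩ := h1 X hX
      have := ih X hX (hG.rightOption hX) (hH.rightOption hY) hYX
      have := hY.minLength_le
      omega

/-- Summands can be cancelled in comparisons of Left dead ends. -/
theorem le_of_add_le_add {G H X : Form} (hG : IsLeftDeadEnd G) (hH : IsLeftDeadEnd H)
    (hX : IsLeftDeadEnd X) (h : H + X ≤ G + X) : H ≤ G := by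
  induction G using rightOption_induction generalizing H X with
  | h G ih =>
    refine (hG.le_iff hH).2 ⟨fun G' hG' => ?_, fun hr => ?_⟩
    -- If the option lies in `H`, induction on `G` cancels `Y`. If it is `H + Y'`, the move to `G' +
    -- Y'` must be answered from `H + Y'`, and the same situation recurs with the smaller `Y'`.
    · have key : ∀ Y, IsLeftDeadEnd Y → (∃ Z, IsRightOption Z (H + Y) ∧ Z ≤ G' + Y) →
          ∃ Z, IsRightOption Z H ∧ Z ≤ G' := by
        intro Y
        induction Y using rightOption_induction with
        | h Y ihY =>
          rintro hY ⟨Z, hZ, hle⟩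
          rcases isRightOption_add.1 hZ with ⟨H', hH', rfl⟩ | ⟨Y', hY', rfl⟩
          · exact ⟨H', hH', ih G' hG' (hG.rightOption hG') (hH.rightOption hH') hY hle⟩
          · have hd := hY.rightOption hY'
            exact ihY Y' hY' hd
              ((((isLeftDeadEnd_add (hG.rightOption hG') hY).le_iff
                (isLeftDeadEnd_add hH hd)).1 hle).1 _ (isRightOption_add.2 (.inr ⟨Y', hY', rfl⟩)))
      exact key X hX ((((isLeftDeadEnd_add hG hX).le_iff (isLeftDeadEnd_add hH hX)).1 h).1 _
        (isRightOption_add.2 (.inl ⟨G', hG', rfl⟩)))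
    · have := minLength_mono (isLeftDeadEnd_add hG hX) (isLeftDeadEnd_add hH hX) h
      rw [minLength_add, minLength_add, hr.minLength] at this
      exact minLength_eq_zero.1 (by omega)

end Form

/-! ### The ordered cancellative monoid of values. -/

open Form AddFactor

namespace DeadEndMonoid

theorem exists_value (a : DeadEndMonoid) : ∃ A : LeftDeadEnd, A.value = a :=
  Quotient.exists_rep a

theorem value_add (A B : LeftDeadEnd) :
    A.value + B.value = LeftDeadEnd.value ⟨A.1 + B.1, isLeftDeadEnd_add A.2 B.2⟩ := rfl

theorem value_le_value {A B : LeftDeadEnd} : A.value ≤ B.value ↔ A.1 ≤ B.1 := Iff.rfl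

theorem value_lt_value {A B : LeftDeadEnd} : A.value < B.value ↔ A.1 < B.1 := by
  rw [lt_iff_le_not_ge, lt_iff_le_not_ge, value_le_value, value_le_value]

theorem value_zero : LeftDeadEnd.value ⟨0, isLeftDeadEnd_zero⟩ = 0 := rfl

theorem le_of_add_le_add_right {a b c : DeadEndMonoid} (h : a + c ≤ b + c) : a ≤ b := by
  obtain ⟨A, rfl⟩ := exists_value a
  obtain ⟨B, rfl⟩ := exists_value b
  obtain ⟨C, rfl⟩ := exists_value c
  exact le_of_add_le_add B.2 A.2 C.2 h

theorem add_le_add {a b c d : DeadEndMonoid} (h : a ≤ b) (h' : c ≤ d) : a + c ≤ b + d := by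
  obtain ⟨A, rfl⟩ := exists_value a
  obtain ⟨B, rfl⟩ := exists_value b
  obtain ⟨C, rfl⟩ := exists_value c
  obtain ⟨D, rfl⟩ := exists_value d
  exact add_le_add' h h'

instance : IsCancelAdd DeadEndMonoid :=
  have h : ∀ a b c : DeadEndMonoid, b + a = c + a → b = c := fun _ _ _ h =>
    le_antisymm (le_of_add_le_add_right h.le) (le_of_add_le_add_right h.ge)
  { add_left_cancel := fun a b c e => h a b c (by rwa [add_comm b, add_comm c])
    add_right_cancel := fun a b c e => h a b c e }

/-- `Form.minLength` on values. -/
noncomputable def minLength : DeadEndMonoid →+ ℕ where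
  toFun := Quotient.lift (fun A : LeftDeadEnd => A.1.minLength) fun A B h =>
    le_antisymm (minLength_mono B.2 A.2 h.1) (minLength_mono A.2 B.2 h.2)
  map_zero' := minLength_eq_zero.2 not_isRightOption_zero
  map_add' := by
    rintro ⟨a⟩ ⟨b⟩
    exact Form.minLength_add a.1 b.1

theorem minLength_value (A : LeftDeadEnd) : minLength A.value = A.1.minLength := rfl

theorem eq_zero_of_minLength (a : DeadEndMonoid) (h : minLength a = 0) : a = 0 := by
  obtain ⟨A, rfl⟩ := exists_value a
  rw [minLength_value, minLength_eq_zero] at h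
  refine le_antisymm ?_ ?_
  · exact (isLeftDeadEnd_zero.le_iff A.2).2
      ⟨fun X hX => absurd hX (not_isRightOption_zero X), fun _ => h⟩
  · exact (A.2.le_iff isLeftDeadEnd_zero).2
      ⟨fun X hX => absurd hX (h X), fun _ => not_isRightOption_zero⟩

instance : Subsingleton (AddUnits DeadEndMonoid) := by
  have h : ∀ u : AddUnits DeadEndMonoid, u = 0 := fun u => by
    have h := congrArg minLength u.add_neg
    rw [map_add, map_zero] at h
    exact AddUnits.ext (eq_zero_of_minLength _ (by omega))
  exact ⟨fun u v => (h u).trans (h v).symm⟩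

/-! ### Good options of sums. -/

/-- The upward closure of the set of Right options of `a`. -/
def AboveOption (x a : DeadEndMonoid) : Prop :=
  ∃ A X : LeftDeadEnd, A.value = a ∧ IsRightOption X.1 A.1 ∧ X.value ≤ x

/-- Equal forms may have different options, but by `IsLeftDeadEnd.le_iff` these have the same upward
closure; hence good options can be treated on values. -/
theorem aboveOption_value {x : DeadEndMonoid} {A : LeftDeadEnd} :
    AboveOption x A.value ↔ ∃ X : LeftDeadEnd, IsRightOption X.1 A.1 ∧ X.value ≤ x := by
  refine ⟨fun ⟨B, X, e, hX, h⟩ => ?_, fun ⟨X, hX, h⟩ => ⟨A, X, rfl, hX, h⟩⟩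
  obtain ⟨Y, hY, hYX⟩ := ((B.2.le_iff A.2).1 (value_le_value.1 e.ge)).1 X.1 hX
  exact ⟨⟨Y, A.2.rightOption hY⟩, hY, le_trans (value_le_value.2 hYX) h⟩

theorem not_aboveOption_zero (x : DeadEndMonoid) : ¬ AboveOption x 0 := by
  rw [← value_zero, aboveOption_value]
  rintro ⟨X, hX, _⟩
  exact not_isRightOption_zero _ hX

theorem aboveOption_add {x a b : DeadEndMonoid} : AboveOption x (a + b) ↔
    (∃ a', AboveOption a' a ∧ a' + b ≤ x) ∨ (∃ b', AboveOption b' b ∧ a + b' ≤ x) := by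
  obtain ⟨A, rfl⟩ := exists_value a
  obtain ⟨B, rfl⟩ := exists_value b
  rw [value_add]
  simp only [aboveOption_value]
  constructor
  · rintro ⟨⟨X, hXd⟩, hX, h⟩
    rcases isRightOption_add.1 hX with ⟨Y, hY, rfl⟩ | ⟨Y, hY, rfl⟩
    · exact .inl ⟨_, ⟨⟨Y, A.2.rightOption hY⟩, hY, le_rfl⟩, h⟩
    · exact .inr ⟨_, ⟨⟨Y, B.2.rightOption hY⟩, hY, le_rfl⟩, h⟩
  · rintro (⟨_, ⟨Y, hY, h'⟩, h⟩ | ⟨_, ⟨Y, hY, h'⟩, h⟩)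
    · exact ⟨⟨Y.1 + B.1, isLeftDeadEnd_add Y.2 B.2⟩, isRightOption_add.2 (.inl ⟨_, hY, rfl⟩),
        (add_le_add h' le_rfl).trans h⟩
    · exact ⟨⟨A.1 + Y.1, isLeftDeadEnd_add A.2 Y.2⟩, isRightOption_add.2 (.inr ⟨_, hY, rfl⟩),
        (add_le_add le_rfl h').trans h⟩

/-- The values of the good options of `a`. -/
def IsGoodOption (x a : DeadEndMonoid) : Prop := Minimal (AboveOption · a) x

theorem isGoodOption_value {X A : LeftDeadEnd} (h : IsGoodRightOption X.1 A.1) :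
    IsGoodOption X.value A.value := by
  refine ⟨aboveOption_value.2 ⟨X, h.1, le_rfl⟩, fun y hy hyX => ?_⟩
  obtain ⟨Y, hY, hle⟩ := aboveOption_value.1 hy
  by_contra hc
  exact h.2 Y.1 hY (value_lt_value.1 (hle.trans_lt (lt_of_le_not_ge hyX hc)))

/-- All summands are equal, so it does not matter in which copy Right moves. -/
theorem aboveOption_succ_nsmul {x a : DeadEndMonoid} {n : ℕ}
    (h : AboveOption x ((n + 1) • a)) : ∃ a', AboveOption a' a ∧ a' + n • a ≤ x := by
  induction n generalizing x with
  | zero => exact ⟨x, by simpa using h, by simp⟩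
  | succ n ih =>
    rw [succ_nsmul', aboveOption_add] at h
    rcases h with h | ⟨b, hb, hle⟩
    · exact h
    · obtain ⟨a', ha', h'⟩ := ih hb
      refine ⟨a', ha', le_trans (le_of_eq ?_) ((add_le_add le_rfl h').trans hle)⟩
      rw [succ_nsmul']
      abel

theorem IsGoodOption.add_nsmul {x a : DeadEndMonoid} (h : IsGoodOption x a) (n : ℕ) :
    IsGoodOption (x + n • a) ((n + 1) • a) := by
  refine ⟨?_, fun y hy hle => ?_⟩
  · rw [succ_nsmul']
    exact aboveOption_add.2 (.inl ⟨x, h.1, le_rfl⟩)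
  · obtain ⟨a', ha', h'⟩ := aboveOption_succ_nsmul hy
    exact (add_le_add (h.2 ha' (le_of_add_le_add_right (h'.trans hle))) le_rfl).trans h'

/-- Minimality of `x` turns `hle` into an equality; anything below `a'` improves `a' + b` as well,
so cancelling `b` gives minimality of `a'`. -/
theorem IsGoodOption.of_le_add {x a b a' : DeadEndMonoid} (h : IsGoodOption x (a + b))
    (ha : AboveOption a' a) (hle : a' + b ≤ x) : IsGoodOption a' a ∧ x = a' + b := by
  have hx : ∀ y, AboveOption y a → y + b ≤ x → x ≤ y + b := fun y hy hyx =>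
    h.2 (aboveOption_add.2 (.inl ⟨y, hy, le_rfl⟩)) hyx
  exact ⟨⟨ha, fun y hy hya => le_of_add_le_add_right
    (hle.trans (hx y hy ((add_le_add hya le_rfl).trans hle)))⟩, le_antisymm (hx a' ha hle) hle⟩

theorem IsGoodOption.of_add {x a b : DeadEndMonoid} (h : IsGoodOption x (a + b)) :
    (∃ a', IsGoodOption a' a ∧ x = a' + b) ∨ (∃ b', IsGoodOption b' b ∧ x = b' + a) := by
  rcases aboveOption_add.1 h.1 with ⟨a', ha, hle⟩ | ⟨b', hb, hle⟩
  · exact .inl ⟨a', h.of_le_add ha hle⟩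
  · rw [add_comm] at h hle
    exact .inr ⟨b', h.of_le_add hb hle⟩

theorem IsGoodOption.of_sum {x : DeadEndMonoid} {s : Multiset DeadEndMonoid}
    (h : IsGoodOption x s.sum) :
    ∃ a t a', s = a ::ₘ t ∧ IsGoodOption a' a ∧ x = a' + t.sum := by
  induction s using Multiset.induction generalizing x with
  | empty => exact absurd h.1 (not_aboveOption_zero x)
  | cons b s ih =>
    rw [Multiset.sum_cons] at h
    rcases h.of_add with ⟨b', hb, e⟩ | ⟨y, hy, rfl⟩
    · exact ⟨b, s, b', rfl, hb, e⟩
    · obtain ⟨a, t, a', rfl, ha, rfl⟩ := ih hy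
      exact ⟨a, b ::ₘ t, a', Multiset.cons_swap b a t, ha, by rw [Multiset.sum_cons]; abel⟩

/-! ### Unique factorisation from a good option. -/

theorem exists_factorisation (a : DeadEndMonoid) : ∃ s, IsFactorisation s a :=
  exists_isFactorisation minLength eq_zero_of_minLength a

/-- An element with a prime-factorisable good option is a prime-factorisable element plus an atom
with a prime-factorisable good option. -/
theorem exists_eq_add_atom {g x : DeadEndMonoid} (hx : IsGoodOption x g)
    (hp : PrimeFactorisable x) : ∃ p a a', g = p + a ∧ PrimeFactorisable p ∧ AddIrreducible a ∧
      IsGoodOption a' a ∧ PrimeFactorisable a' := by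
  obtain ⟨s, hs, rfl⟩ := exists_factorisation g
  obtain ⟨a, t, a', rfl, ha', rfl⟩ := hx.of_sum
  obtain ⟨u, hu⟩ := exists_factorisation a'
  simp only [Multiset.mem_cons, forall_eq_or_imp] at hs
  have ht : IsFactorisation t t.sum := ⟨hs.2, rfl⟩
  -- The atoms of `a'` and those of `t` together factor the good option, so all are prime.
  have h := hp.isPrime_of_mem (hu.add ht)
  exact ⟨t.sum, a, a', by rw [Multiset.sum_cons, add_comm],
    ⟨t, ht, fun q hq => h q (Multiset.mem_add.2 (.inr hq))⟩, hs.1, ha',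
    ⟨u, hu, fun q hq => h q (Multiset.mem_add.2 (.inl hq))⟩⟩

theorem uniquelyFactorisable_nsmul_of_atom {a a' : DeadEndMonoid} (ha : AddIrreducible a)
    (ha' : IsGoodOption a' a) (hp : PrimeFactorisable a') (n : ℕ) :
    UniquelyFactorisable (n • a) := by
  induction n with
  | zero => simpa using uniquelyFactorisable_zero
  | succ n ih =>
    refine ⟨_, isFactorisation_replicate ha _, fun s hs => ?_⟩
    have has : a ∈ s := by
      have hg := ha'.add_nsmul n
      rw [← hs.2] at hg
      obtain ⟨b, t, b', rfl, -, e⟩ := hg.of_sum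
      -- If `b` is the only atom, then `b = a + n • a` forces `b = a`.
      rcases t.empty_or_exists_mem with rfl | ⟨c, hc⟩
      · have hb : b = a + n • a := by simpa [succ_nsmul'] using hs.2
        rcases (hs.1 b (by simp)).isAddUnit_or_isAddUnit hb with h | h
        · exact absurd h ha.not_isAddUnit
        · rw [isAddUnit_iff_eq_zero] at h
          simp [hb, h]
      · obtain ⟨u, hu⟩ := exists_factorisation b'
        have hu' := hp.add_uniquelyFactorisable ih
        obtain ⟨q, hq, hqp⟩ := hp
        -- Two factorisations of the same good option: one through `b'` and `t`, one through primes
        -- and copies of `a`.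
        have h := hu'.eq (e ▸ hu.add ⟨fun y hy => hs.1 y (Multiset.mem_cons_of_mem hy), rfl⟩)
          (hq.add (isFactorisation_replicate ha n))
        have hcs : c ∈ b ::ₘ t := Multiset.mem_cons_of_mem hc
        have hca : c = a := by
          rcases Multiset.mem_add.1 (h ▸ Multiset.mem_add.2 (.inr hc)) with h | h
          -- Here `c` is prime and divides `(n + 1) • a`, so it is one of the copies of `a`.
          · obtain ⟨w, hw⟩ := Multiset.exists_cons_of_mem hcs
            have hr := isFactorisation_replicate ha (n + 1)
            refine Multiset.eq_of_mem_replicate ((hqp c h).mem_of_divides_sum hr.1 ⟨w.sum, ?_⟩)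
            rw [hr.2, ← hs.2, hw, Multiset.sum_cons]
          · exact Multiset.eq_of_mem_replicate h
        exact hca ▸ hcs
    obtain ⟨t, rfl⟩ := Multiset.exists_cons_of_mem has
    have hsum := hs.2
    rw [Multiset.sum_cons, succ_nsmul'] at hsum
    rw [Multiset.replicate_succ, ih.eq
      ⟨fun y hy => hs.1 y (Multiset.mem_cons_of_mem hy), add_left_cancel hsum⟩
      (isFactorisation_replicate ha n)]

end DeadEndMonoid

end Misere

theorem mainTheorem10 (G : Misere.LeftDeadEnd)
    (hG : ∃ G' : Misere.LeftDeadEnd,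
      Misere.Form.IsGoodRightOption G'.1 G.1 ∧ AddFactor.PrimeFactorisable G'.value) :
    (∀ n : ℕ, AddFactor.UniquelyFactorisable (n • G.value)) ∧
      (AddIrreducible G.value → AddFactor.IsStrongAtom G.value) := by
  obtain ⟨G', hG', hp⟩ := hG
  have hu : ∀ n : ℕ, AddFactor.UniquelyFactorisable (n • G.value) := by
    intro n
    obtain ⟨p, a, a', e, hpp, ha, ha', hpa⟩ :=
      Misere.DeadEndMonoid.exists_eq_add_atom (Misere.DeadEndMonoid.isGoodOption_value hG') hp
    rw [e, nsmul_add]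
    exact (hpp.nsmul n).add_uniquelyFactorisable
      (Misere.DeadEndMonoid.uniquelyFactorisable_nsmul_of_atom ha ha' hpa n)
  refine ⟨hu, fun hG => ⟨hG, fun n b hb => ?_⟩⟩
  obtain ⟨k, hk⟩ := (hu n).exists_eq_nsmul hG Misere.DeadEndMonoid.exists_factorisation hb
  exact ⟨k, 0, isAddUnit_zero, by rw [hk, add_zero]⟩
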